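/- A diffeological space is a set $X$ with a family of maps into $X$ (its plots), defined on open subsets of the spaces $\mathbb{R}^n$, $n\ge 0$, which contains all constant maps, is closed under precomposition with smooth maps, and contains every map that is locally a plot. Its $D$-topology is the finest topology on $X$ for which all plots are continuous; write $D(X)$ for $X$ with this topology. A map into a product is a plot iff its components are plots, and $\mathbb{R}$ and every open subset $U$ of a Euclidean space carry the diffeology whose plots are the smooth maps. For a diffeological space $X$, the free diffeological vector space $F(X)$ is the real vector space $\bigoplus_{x\in X}\mathbb{R}$ with basis $\{[x]: x\in X\}$, equipped with the diffeology generated by the maps $$\rho_n:(\mathbb{R}\times X)^n\to F(X),\qquad (r_1,x_1,\dots,r_n,x_n)\mapsto \sum_{i=1}^n r_i[x_i],\qquad n\ge 1,$$ i.e. the smallest diffeology containing $\rho_n\circ p$ for all $n\ge 1$ and all plots $p$ of $(\mathbb{R}\times X)^n$. A $k_\omega$-space is a Hausdorff space $Y$ with a countable cover $\{K_n\}_{n\in\mathbb{N}}$ by compact subsets such that a set $A\subseteq Y$ is closed if and only if $A\cap K_n$ is closed in $K_n$ for every $n$. **Theorem.** Let $U$ be an open subset of a Euclidean space $\mathbb{R}^d$,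 $d\ge 0$. Then the $D$-topology makes $F(U)$ a topological vector space over $\mathbb{R}$ (addition, negation and scalar multiplication are continuous for the product topologies) whose topology is Hausdorff and normal. Moreover, $D(F(U))$ is a $k_\omega$-space, and $D(F(U)\times F(U))=D(F(U))\times D(F(U))$, i.e. the $D$-topology of the product diffeology on $F(U)\times F(U)$ is the product topology of the $D$-topologies. -/

import Mathlib

open Diffeology in
/-- The subspace diffeology: a map into `{x // P x}` is a plot iff it is a plot of `X`. -/
instance Subtype.instDiffeologicalSpace {X : Type*} [DiffeologicalSpace X] (P : X → Prop) :
    DiffeologicalSpace {x : X // P x} where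
  plots n := {p | IsPlot (fun t ↦ (p t : X))}
  constant_plots _ := isPlot_const
  plot_reparam hp hf := isPlot_reparam hp hf
  locality hp := DiffeologicalSpace.locality hp

open Diffeology in
/-- The product diffeology on `X × Y`: a map is a plot iff both its components are plots. -/
instance Prod.instDiffeologicalSpace {X Y : Type*} [DiffeologicalSpace X] [DiffeologicalSpace Y] :
    DiffeologicalSpace (X × Y) where
  plots n := {p | IsPlot (fun t ↦ (p t).1) ∧ IsPlot (fun t ↦ (p t).2)}
  constant_plots _ := ⟨isPlot_const, isPlot_const⟩
  plot_reparam hp hf := ⟨isPlot_reparam hp.1 hf, isPlot_reparam hp.2 hf⟩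
  locality hp := by
    constructor
    · refine DiffeologicalSpace.locality fun x ↦ ?_
      obtain ⟨u, hu, hxu, h⟩ := hp x
      exact ⟨u, hu, hxu, fun hfu hf ↦ (h hfu hf).1⟩
    · refine DiffeologicalSpace.locality fun x ↦ ?_
      obtain ⟨u, hu, hxu, h⟩ := hp x
      exact ⟨u, hu, hxu, fun hfu hf ↦ (h hfu hf).2⟩

open Diffeology in
/-- The product diffeology on `∀ i, X i`: a map is a plot iff all its components are plots. -/
instance Pi.instDiffeologicalSpace {ι : Type*} {X : ι → Type*} [∀ i, DiffeologicalSpace (X i)] :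
    DiffeologicalSpace (∀ i, X i) where
  plots n := {p | ∀ i, IsPlot (fun t ↦ p t i)}
  constant_plots _ := fun _ ↦ isPlot_const
  plot_reparam hp hf := fun i ↦ isPlot_reparam (hp i) hf
  locality hp := fun i ↦ by
    refine DiffeologicalSpace.locality fun x ↦ ?_
    obtain ⟨u, hu, hxu, h⟩ := hp x
    exact ⟨u, hu, hxu, fun hfu hf ↦ h hfu hf i⟩

/-- The real vector space `⊕_{x ∈ X} ℝ` underlying the free diffeological vector space on `X`. -/
def FreeDiffeologicalVectorSpace (X : Type*) : Type _ := X →₀ ℝ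

namespace FreeDiffeologicalVectorSpace

noncomputable instance (X : Type*) : AddCommGroup (FreeDiffeologicalVectorSpace X) :=
  inferInstanceAs (AddCommGroup (X →₀ ℝ))

noncomputable instance (X : Type*) : Module ℝ (FreeDiffeologicalVectorSpace X) :=
  inferInstanceAs (Module ℝ (X →₀ ℝ))

/-- The basis vector `[x]` corresponding to `x : X`. -/
noncomputable def basisVector {X : Type*} (x : X) : FreeDiffeologicalVectorSpace X :=
  Finsupp.single x (1 : ℝ)

/-- The map `(ℝ × X)ⁿ → F(X)`, `(r₁, x₁, …, rₙ, xₙ) ↦ r₁ [x₁] + ⋯ + rₙ [xₙ]`. -/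
noncomputable def rho {X : Type*} (n : ℕ) (v : Fin n → ℝ × X) : FreeDiffeologicalVectorSpace X :=
  ∑ i, (v i).1 • basisVector (v i).2

/-- The diffeology of `F(X)`: the one generated by the maps `rho n : (ℝ × X)ⁿ → F(X)`, `n ≥ 1`,
that is, by their composites with all plots of the diffeological space `(ℝ × X)ⁿ`. -/
noncomputable instance (X : Type*) [DiffeologicalSpace X] :
    DiffeologicalSpace (FreeDiffeologicalVectorSpace X) :=
  DiffeologicalSpace.generateFrom
    {q | ∃ n : ℕ, 0 < n ∧ ∃ p : EuclideanSpace ℝ (Fin q.1) → (Fin n → ℝ × X),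
      Diffeology.IsPlot p ∧ q.2 = fun t ↦ rho n (p t)}

end FreeDiffeologicalVectorSpace

/-- A `k_ω`-space: a Hausdorff space with a countable cover by compact sets `K n` such that a set
`F` is closed iff `F ∩ K n` is closed in `K n` for every `n`. -/
def IsKOmegaSpace (X : Type*) [TopologicalSpace X] : Prop :=
  T2Space X ∧ ∃ K : ℕ → Set X, (∀ n, IsCompact (K n)) ∧ (⋃ n, K n) = Set.univ ∧
    ∀ F : Set X, IsClosed F ↔ ∀ n, IsClosed ((↑) ⁻¹' F : Set (K n))

/-! The maps `rho n` assemble into a surjection `sigmaRho` from the disjoint union of the `(ℝ ×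
U)ⁿ`, a locally compact σ-compact space. It is a quotient map onto `D(F(U))`, because openness in
`(ℝ × U)ⁿ` can be tested on smooth maps. Linear extensions of continuous functions on `U` separate
points, so the quotient is Hausdorff, and images of a compact exhaustion determine its topology.

The crux is `IsKOmegaCover.prod`: such covers are stable under products. Hence `sigmaRho × sigmaRho`
is again a quotient map, so addition and scalar multiplication are continuous because concatenation
and rescaling of tuples are, and the two topologies on the product agree. -/

open Set Topology

/-! ### Compact covers determining a topology -/

/-- An increasing sequence of compact sets covering `X` which determines the topology of `X`. -/
structure IsKOmegaCover {X : Type*} [TopologicalSpace X] (K : ℕ → Set X) : Prop where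
  monotone : Monotone K
  isCompact : ∀ n, IsCompact (K n)
  exists_mem : ∀ x, ∃ n, x ∈ K n
  isOpen_of_forall_inter : ∀ A : Set X, (∀ n, ∃ O, IsOpen O ∧ A ∩ K n = O ∩ K n) → IsOpen A

namespace IsKOmegaCover

variable {X Y : Type*} [TopologicalSpace X] [TopologicalSpace Y]

theorem comp_add {K : ℕ → Set X} (hK : IsKOmegaCover K) (N : ℕ) :
    IsKOmegaCover fun n ↦ K (n + N) where
  monotone _ _ h := hK.monotone (by omega)
  isCompact n := hK.isCompact _
  exists_mem x := by
    obtain ⟨n, hn⟩ := hK.exists_mem x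
    exact ⟨n, hK.monotone (by omega) hn⟩
  isOpen_of_forall_inter A hA := by
    refine hK.isOpen_of_forall_inter A fun n ↦ ?_
    obtain ⟨O, hO, h⟩ := hA n
    have hn : K n ⊆ K (n + N) := hK.monotone (by omega)
    refine ⟨O, hO, ?_⟩
    rw [← inter_eq_self_of_subset_right hn, ← inter_assoc, h, inter_assoc]

/-- A union of sets `A n ⊆ K n`, each of which has the next one as a neighbourhood in `K (n + 1)`,
is open. -/
theorem isOpen_iUnion_of_chain {K : ℕ → Set X} (hK : IsKOmegaCover K) {A G : ℕ → Set X}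
    (hAK : ∀ n, A n ⊆ K n) (hG : ∀ n, IsOpen (G n)) (hAG : ∀ n, A n ⊆ G n)
    (hGA : ∀ n, G n ∩ K (n + 1) ⊆ A (n + 1)) : IsOpen (⋃ n, A n) := by
  have hmono : Monotone A := monotone_nat_of_le_succ fun n x hx ↦
    hGA n ⟨hAG n hx, hK.monotone n.le_succ (hAK n hx)⟩
  -- For `m ≥ n` one has `K n ⊆ K (m + 1)`, so `hGA` puts the trace of `G m` on `K n` inside `A (m +
  -- 1)`.
  refine hK.isOpen_of_forall_inter _ fun n ↦
    ⟨⋃ m ∈ Ici n, G m, isOpen_biUnion fun m _ ↦ hG m, ?_⟩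
  ext x
  simp only [mem_inter_iff, mem_iUnion, mem_Ici, exists_prop]
  refine and_congr_left fun hx ↦ ⟨?_, ?_⟩
  · rintro ⟨m, hm⟩
    exact ⟨max m n, le_max_right _ _, hAG _ (hmono (le_max_left _ _) hm)⟩
  · rintro ⟨m, hnm, hm⟩
    exact ⟨m + 1, hGA m ⟨hm, hK.monotone (by omega) hx⟩⟩

/-- A compact set inside an open set `O` has a compact neighbourhood inside `O`, relatively to a
compact set `K` of a Hausdorff space. -/
theorem _root_.IsCompact.exists_relative_compact_nhds [T2Space X] {A K O : Set X}
    (hA : IsCompact A) (hK : IsCompact K) (hO : IsOpen O) (hAO : A ⊆ O) :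
    ∃ A' G : Set X, IsCompact A' ∧ A' ⊆ K ∧ A' ⊆ O ∧ IsOpen G ∧ A ⊆ G ∧ G ∩ K ⊆ A' := by
  obtain ⟨G, H, hG, hH, hAG, hKH, hGH⟩ := SeparatedNhds.of_isCompact_isCompact hA (hK.diff hO)
    (disjoint_left.2 fun x hx hx' ↦ hx'.2 (hAO hx))
  refine ⟨K \ H, G, hK.diff hH, sdiff_subset, fun x hx ↦ ?_, hG, hAG, fun x hx ↦
    ⟨hx.2, disjoint_left.1 hGH hx.1⟩⟩
  by_contra hxO
  exact hx.2 (hKH ⟨hx.1, hxO⟩)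

/-- Compact boxes inside `W` are grown from a point: at each stage the tube lemma leaves room for a
larger box that is a neighbourhood of the previous one relative to the next compact sets. The unions
of the two sides are open by `isOpen_iUnion_of_chain`. -/
theorem prod [T2Space X] [T2Space Y] {K : ℕ → Set X} {L : ℕ → Set Y} (hK : IsKOmegaCover K)
    (hL : IsKOmegaCover L) : IsKOmegaCover fun n ↦ K n ×ˢ L n where
  monotone _ _ h := prod_mono (hK.monotone h) (hL.monotone h)
  isCompact n := (hK.isCompact n).prod (hL.isCompact n)
  exists_mem := by
    rintro ⟨x, y⟩
    obtain ⟨m, hm⟩ := hK.exists_mem x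
    obtain ⟨n, hn⟩ := hL.exists_mem y
    exact ⟨max m n, hK.monotone (le_max_left _ _) hm, hL.monotone (le_max_right _ _) hn⟩
  isOpen_of_forall_inter W hW := by
    rw [isOpen_iff_mem_nhds]
    rintro ⟨x, y⟩ hxy
    obtain ⟨m, hm⟩ := hK.exists_mem x
    obtain ⟨n, hn⟩ := hL.exists_mem y
    set N := max m n
    -- After the shift by `N`, stage `0` already contains both coordinates of the point.
    have hK' := hK.comp_add N
    have hL' := hL.comp_add N
    have hxN : x ∈ K (0 + N) := by simpa [N] using hK.monotone (le_max_left m n) hm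
    have hyN : y ∈ L (0 + N) := by simpa [N] using hL.monotone (le_max_right m n) hn
    let P (n : ℕ) (A : Set X × Set Y) : Prop := IsCompact A.1 ∧ IsCompact A.2 ∧
      A.1 ⊆ K (n + N) ∧ A.2 ⊆ L (n + N) ∧ A.1 ×ˢ A.2 ⊆ W
    have step (n : ℕ) (A : {A // P n A}) : ∃ A' : {A // P (n + 1) A}, ∃ G : Set X × Set Y,
        IsOpen G.1 ∧ IsOpen G.2 ∧ A.1.1 ⊆ G.1 ∧ A.1.2 ⊆ G.2 ∧
        G.1 ∩ K (n + 1 + N) ⊆ A'.1.1 ∧ G.2 ∩ L (n + 1 + N) ⊆ A'.1.2 := by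
      obtain ⟨⟨A, B⟩, hA, hB, hAK, hBL, hAB⟩ := A
      obtain ⟨W', hW', hWW'⟩ := hW (n + 1 + N)
      dsimp only at hA hB hAK hBL hAB hWW'
      have hsub : A ×ˢ B ⊆ W' := fun z hz ↦
        (hWW'.subset ⟨hAB hz, hK.monotone (by omega) (hAK hz.1),
          hL.monotone (by omega) (hBL hz.2)⟩).1
      obtain ⟨O, Q, hO, hQ, hAO, hBQ, hOQ⟩ := generalized_tube_lemma hA hB hW' hsub
      obtain ⟨A', G, hA', hA'K, hA'O, hG, hAG, hGA'⟩ :=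
        hA.exists_relative_compact_nhds (hK.isCompact (n + 1 + N)) hO hAO
      obtain ⟨B', H, hB', hB'L, hB'Q, hH, hBH, hHB'⟩ :=
        hB.exists_relative_compact_nhds (hL.isCompact (n + 1 + N)) hQ hBQ
      exact ⟨⟨(A', B'), hA', hB', hA'K, hB'L, fun z hz ↦
        (hWW'.superset ⟨hOQ ⟨hA'O hz.1, hB'Q hz.2⟩, hA'K hz.1, hB'L hz.2⟩).1⟩,
        (G, H), hG, hH, hAG, hBH, hGA', hHB'⟩
    choose next G hG hH hAG hBH hGA hHB using step
    let A (n : ℕ) : {A // P n A} := Nat.rec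
      ⟨({x}, {y}), isCompact_singleton, isCompact_singleton,
        singleton_subset_iff.2 hxN, singleton_subset_iff.2 hyN, by simpa using hxy⟩ next n
    have hA1 : IsOpen (⋃ n, (A n).1.1) := hK'.isOpen_iUnion_of_chain
      (fun n ↦ (A n).2.2.2.1) (fun n ↦ hG n (A n)) (fun n ↦ hAG n (A n)) (fun n ↦ hGA n (A n))
    have hA2 : IsOpen (⋃ n, (A n).1.2) := hL'.isOpen_iUnion_of_chain
      (fun n ↦ (A n).2.2.2.2.1) (fun n ↦ hH n (A n)) (fun n ↦ hBH n (A n)) (fun n ↦ hHB n (A n))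
    have mono1 : Monotone fun n ↦ (A n).1.1 := monotone_nat_of_le_succ fun n z hz ↦
      hGA n (A n) ⟨hAG n (A n) hz, hK.monotone (by omega) ((A n).2.2.2.1 hz)⟩
    have mono2 : Monotone fun n ↦ (A n).1.2 := monotone_nat_of_le_succ fun n z hz ↦
      hHB n (A n) ⟨hBH n (A n) hz, hL.monotone (by omega) ((A n).2.2.2.2.1 hz)⟩
    refine Filter.mem_of_superset ((hA1.prod hA2).mem_nhds
      ⟨mem_iUnion.2 ⟨0, mem_singleton x⟩, mem_iUnion.2 ⟨0, mem_singleton y⟩⟩) ?_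
    rintro ⟨u, v⟩ ⟨hu, hv⟩
    obtain ⟨i, hi⟩ := mem_iUnion.1 hu
    obtain ⟨j, hj⟩ := mem_iUnion.1 hv
    exact (A (max i j)).2.2.2.2.2 ⟨mono1 (le_max_left i j) hi, mono2 (le_max_right i j) hj⟩

theorem isKOmegaSpace [T2Space X] {K : ℕ → Set X} (hK : IsKOmegaCover K) : IsKOmegaSpace X := by
  refine ⟨inferInstance, K, hK.isCompact, eq_univ_of_forall fun x ↦ mem_iUnion.2 (hK.exists_mem x),
    fun F ↦ ⟨fun hF n ↦ hF.preimage continuous_subtype_val, fun hF ↦ ?_⟩⟩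
  rw [← isOpen_compl_iff]
  refine hK.isOpen_of_forall_inter _ fun n ↦ ?_
  obtain ⟨O, hO, h⟩ := isOpen_induced_iff.1 (hF n).isOpen_compl
  refine ⟨O, hO, ?_⟩
  ext x
  refine and_congr_left fun hx ↦ ?_
  exact (Set.ext_iff.1 h ⟨x, hx⟩).symm

end IsKOmegaCover

/-! ### Quotients of locally compact σ-compact spaces -/

namespace Topology.IsQuotientMap

variable {Y Z F G : Type*} [TopologicalSpace Y] [TopologicalSpace Z] [TopologicalSpace F]
  [TopologicalSpace G]

theorem isKOmegaCover {q : Y → F} (hq : IsQuotientMap q) (Q : CompactExhaustion Y) [T2Space F] :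
    IsKOmegaCover fun n ↦ q '' Q n where
  monotone _ _ h := image_mono (Q.subset h)
  isCompact n := (Q.isCompact n).image hq.continuous
  exists_mem x := by
    obtain ⟨y, rfl⟩ := hq.surjective x
    obtain ⟨n, hn⟩ := Q.exists_mem y
    exact ⟨n, mem_image_of_mem q hn⟩
  isOpen_of_forall_inter A hA := by
    rw [← hq.isOpen_preimage, isOpen_iff_mem_nhds]
    intro y hy
    obtain ⟨n, hn⟩ := Q.exists_mem_nhds y
    obtain ⟨O, hO, h⟩ := hA n
    have hyO : y ∈ q ⁻¹' O := (h.subset ⟨hy, mem_image_of_mem q (mem_of_mem_nhds hn)⟩).1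
    filter_upwards [hn, (hO.preimage hq.continuous).mem_nhds hyO] with z hz hzO
    exact (h.superset ⟨hzO, mem_image_of_mem q hz⟩).1

/-- A product of two quotient maps from locally compact `σ`-compact spaces onto Hausdorff spaces
is a quotient map. -/
theorem prodMap_of_sigmaCompact [WeaklyLocallyCompactSpace Y] [SigmaCompactSpace Y]
    [WeaklyLocallyCompactSpace Z] [SigmaCompactSpace Z] [T2Space F] [T2Space G]
    {q : Y → F} {r : Z → G} (hq : IsQuotientMap q) (hr : IsQuotientMap r) :
    IsQuotientMap (Prod.map q r) := by
  refine ⟨.of_isOpen_preimage_iff_isOpen fun W ↦ ⟨fun hW ↦ ?_,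
    fun hW ↦ hW.preimage (hq.continuous.prodMap hr.continuous)⟩,
    hq.surjective.prodMap hr.surjective⟩
  let Q : CompactExhaustion Y := default
  let R : CompactExhaustion Z := default
  refine ((hq.isKOmegaCover Q).prod (hr.isKOmegaCover R)).isOpen_of_forall_inter W fun n ↦ ?_
  -- The image of the part of `Q n ×ˢ R n` lying outside the preimage of `W` is compact, hence
  -- closed; its complement has the same trace as `W`.
  have hc : IsCompact (Prod.map q r '' ((Q n ×ˢ R n) \ Prod.map q r ⁻¹' W)) :=
    (((Q.isCompact n).prod (R.isCompact n)).diff hW).image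
      (hq.continuous.prodMap hr.continuous)
  refine ⟨_, hc.isClosed.isOpen_compl, ?_⟩
  ext z
  refine and_congr_left fun hz ↦ ⟨?_, fun h ↦ ?_⟩
  · rintro h ⟨y, hy, rfl⟩
    exact hy.2 h
  · rw [← prodMap_image_prod] at hz
    obtain ⟨y, hy, rfl⟩ := hz
    by_contra hW'
    exact h ⟨y, ⟨hy, hW'⟩, rfl⟩

end Topology.IsQuotientMap

instance Sigma.instWeaklyLocallyCompactSpace {ι : Type*} {X : ι → Type*}
    [∀ i, TopologicalSpace (X i)] [∀ i, WeaklyLocallyCompactSpace (X i)] :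
    WeaklyLocallyCompactSpace (Σ i, X i) where
  exists_compact_mem_nhds := by
    rintro ⟨i, x⟩
    obtain ⟨K, hK, hx⟩ := exists_compact_mem_nhds x
    exact ⟨Sigma.mk i '' K, hK.image continuous_sigmaMk,
      IsOpenEmbedding.sigmaMk.isOpenMap.image_mem_nhds hx⟩
open scoped ContDiff
open Diffeology

/-! ### Testing openness on smooth maps -/

namespace Diffeology

/-- Every neighbourhood of a point of a Euclidean space contains a neighbourhood that is smoothly
parametrized by the whole space. -/
theorem exists_contDiff_isOpenEmbedding {m : ℕ} {O : Set (EuclideanSpace ℝ (Fin m))}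
    (hO : IsOpen O) {x : EuclideanSpace ℝ (Fin m)} (hx : x ∈ O) :
    ∃ φ : EuclideanSpace ℝ (Fin m) → EuclideanSpace ℝ (Fin m),
      ContDiff ℝ ∞ φ ∧ IsOpenEmbedding φ ∧ φ 0 = x ∧ ∀ t, φ t ∈ O := by
  obtain ⟨ε, hε, hε'⟩ := Metric.isOpen_iff.1 hO x hx
  refine ⟨OpenPartialHomeomorph.univBall x ε, OpenPartialHomeomorph.contDiff_univBall,
    OpenPartialHomeomorph.isOpenEmbedding _ (OpenPartialHomeomorph.univBall_source x ε),
    OpenPartialHomeomorph.univBall_apply_zero x ε, fun t ↦ hε' ?_⟩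
  rw [← OpenPartialHomeomorph.univBall_target x hε]
  exact OpenPartialHomeomorph.map_source _
    ((OpenPartialHomeomorph.univBall_source x ε).symm ▸ mem_univ t)

/-- The continuous maps from Euclidean spaces to a topological space form a diffeology. -/
abbrev continuousDiffeology (X : Type*) [TopologicalSpace X] : DiffeologicalSpace X where
  plots _ := {p | Continuous p}
  constant_plots _ := continuous_const
  plot_reparam hp hf := hp.comp hf.continuous
  locality {n p} hp := continuous_iff_continuousAt.2 fun x ↦ by
    obtain ⟨u, hu, hxu, h⟩ := hp x
    obtain ⟨φ, hφ, hφ', rfl, hφu⟩ := exists_contDiff_isOpenEmbedding hu hxu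
    exact hφ'.continuousAt_iff.1 (h hφu hφ).continuousAt

/-- If the generating plots are continuous, then so are all plots of the generated diffeology. -/
theorem dTopology_generateFrom_le {X : Type*} [t : TopologicalSpace X]
    {g : Set ((n : ℕ) × (EuclideanSpace ℝ (Fin n) → X))} (hg : ∀ q ∈ g, Continuous q.2)
    {s : Set X} (hs : IsOpen s) : IsOpen[(DiffeologicalSpace.generateFrom g).dTopology] s := by
  let := DiffeologicalSpace.generateFrom g
  -- A plot of the generated diffeology lies in every diffeology containing `g`, in particular in
  -- the continuous one.
  exact Diffeology.isOpen_iff_preimages_plots.2 fun n p hp ↦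
    hs.preimage (hp (continuousDiffeology X) fun q hq ↦ hg q hq : Continuous p)

/-- Openness in an open subspace of a finite-dimensional normed space can be tested on smooth
maps. -/
theorem isOpen_of_forall_contDiff {E M : Type*} [NormedAddCommGroup E] [NormedSpace ℝ E]
    [FiniteDimensional ℝ E] [TopologicalSpace M] {i : M → E} (hi : IsOpenEmbedding i) {S : Set M}
    (hS : ∀ (m : ℕ) (p : EuclideanSpace ℝ (Fin m) → M), ContDiff ℝ ∞ (i ∘ p) → IsOpen (p ⁻¹' S)) :
    IsOpen S := by
  rw [isOpen_iff_mem_nhds]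
  intro y hy
  let e := toEuclidean (E := E)
  have hei : IsOpenEmbedding (e ∘ i) := e.toHomeomorph.isOpenEmbedding.comp hi
  obtain ⟨φ, hφ, hφ', hφ0, hφr⟩ := exists_contDiff_isOpenEmbedding hei.isOpen_range
    (mem_range_self y)
  choose p hp using hφr
  have hp' : i ∘ p = e.symm ∘ φ := by
    ext t
    simp [← hp]
  have hp0 : p 0 = y := hei.injective ((hp 0).trans hφ0)
  have hpo : IsOpenEmbedding p :=
    IsOpenEmbedding.of_comp _ hei (by rwa [show (e ∘ i) ∘ p = φ from funext hp])
  have h := hS _ p (hp' ▸ e.symm.contDiff.comp hφ)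
  rw [← hp0] at hy ⊢
  exact Filter.mem_of_superset (hpo.isOpenMap.image_mem_nhds (h.mem_nhds hy))
    (image_preimage_subset _ _)

end Diffeology

/-! ### The free diffeological vector space and its quotient presentation -/

namespace FreeDiffeologicalVectorSpace

section

variable {X : Type*}

/-- The map from the disjoint union of all `(ℝ × X)ⁿ` onto `F(X)` given by the maps `rho n`. -/
noncomputable def sigmaRho (X : Type*) (y : Σ n : ℕ, Fin n → ℝ × X) :
    FreeDiffeologicalVectorSpace X :=
  rho y.1 y.2

theorem sigmaRho_append {m n : ℕ} (v : Fin m → ℝ × X) (w : Fin n → ℝ × X) :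
    sigmaRho X ⟨m + n, Fin.append v w⟩ = rho m v + rho n w := by
  simp [sigmaRho, rho, Fin.sum_univ_add]

theorem sigmaRho_smul (c : ℝ) {n : ℕ} (v : Fin n → ℝ × X) :
    sigmaRho X ⟨n, fun i ↦ (c * (v i).1, (v i).2)⟩ = c • rho n v := by
  simp [sigmaRho, rho, Finset.smul_sum, mul_smul]

theorem surjective_sigmaRho : Function.Surjective (sigmaRho X) := by
  intro v
  refine Finsupp.induction_linear (motive := fun v ↦ ∃ y, sigmaRho X y = v) v ?_ ?_ ?_
  · exact ⟨⟨0, Fin.elim0⟩, by simp [sigmaRho, rho]; rfl⟩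
  · rintro f g ⟨⟨m, y⟩, rfl⟩ ⟨⟨n, z⟩, rfl⟩
    exact ⟨_, sigmaRho_append y z⟩
  · intro x r
    refine ⟨⟨1, fun _ ↦ (r, x)⟩, ?_⟩
    simp only [sigmaRho, rho, Finset.univ_unique, Finset.sum_const, Finset.card_singleton, one_smul]
    exact (Finsupp.smul_single_one x r)

/-- The linear extension to `F(X)` of a function on `X`. -/
noncomputable def lift (f : X → ℝ) : FreeDiffeologicalVectorSpace X →ₗ[ℝ] ℝ :=
  Finsupp.linearCombination ℝ f

theorem lift_rho (f : X → ℝ) (n : ℕ) (v : Fin n → ℝ × X) :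
    lift f (rho n v) = ∑ i, (v i).1 * f (v i).2 := by
  simp only [rho, map_sum, map_smul, smul_eq_mul]
  exact Finset.sum_congr rfl fun i _ ↦ congrArg _
    ((Finsupp.linearCombination_single ℝ 1 _).trans (one_smul _ _))

/-- A function equal to `1` at one support point of `v - w` and `0` at the others reads off a
nonzero coefficient. -/
theorem exists_continuous_lift_ne [TopologicalSpace X] [T2Space X] [CompletelyRegularSpace X]
    {v w : FreeDiffeologicalVectorSpace X} (h : v ≠ w) :
    ∃ f : X → ℝ, Continuous f ∧ lift f v ≠ lift f w := by
  classical
  let u : X →₀ ℝ := v - w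
  obtain ⟨x, hx⟩ : ∃ x, u x ≠ 0 := Finsupp.ne_iff.1 (sub_ne_zero.2 h)
  obtain ⟨f, hf, hfx, hfu⟩ := CompletelyRegularSpace.completely_regular x
    (u.support.erase x : Set X) (u.support.erase x).finite_toSet.isClosed (by simp)
  refine ⟨fun y ↦ 1 - (f y : ℝ), by fun_prop, fun heq ↦ hx ?_⟩
  rw [← sub_eq_zero, ← map_sub] at heq
  have h1 : lift (fun y ↦ 1 - (f y : ℝ)) (v - w) = u x * (1 - (f x : ℝ)) := by
    refine (Finsupp.linearCombination_apply ℝ u).trans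
      (Finset.sum_eq_single x (fun y hy hyx ↦ ?_) fun hxu ↦ ?_)
    · simp [hfu (show y ∈ (u.support.erase x : Set X) by simp_all)]
    · simp [Finsupp.notMem_support_iff.1 hxu]
  rw [heq, hfx] at h1
  simpa using h1.symm

end

section

variable {X : Type*} [DiffeologicalSpace X]

theorem isPlot_rho {n m : ℕ} {p : EuclideanSpace ℝ (Fin m) → Fin n → ℝ × X} (hp : IsPlot p) :
    IsPlot fun t ↦ rho n (p t) := by
  -- The generators have `n ≥ 1`; for `n = 0` the map is constant.
  obtain rfl | hn := n.eq_zero_or_pos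
  · have : (fun t ↦ rho 0 (p t)) = fun _ ↦ 0 := by ext1 t; simp [rho]
    exact this ▸ isPlot_const
  · exact DiffeologicalSpace.isPlot_generatedFrom_of_mem ⟨n, hn, p, hp, rfl⟩

end

section

variable {d : ℕ} {U : TopologicalSpace.Opens (EuclideanSpace ℝ (Fin d))}

/-- The inclusion of `(ℝ × U)ⁿ` into `(ℝ × ℝᵈ)ⁿ`. -/
def inclusion (U : TopologicalSpace.Opens (EuclideanSpace ℝ (Fin d))) (n : ℕ)
    (v : Fin n → ℝ × U) : Fin n → ℝ × EuclideanSpace ℝ (Fin d) :=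
  fun i ↦ ((v i).1, (v i).2)

theorem isOpenEmbedding_inclusion (n : ℕ) : IsOpenEmbedding (inclusion U n) :=
  .piMap fun _ ↦ IsOpenEmbedding.id.prodMap U.isOpen.isOpenEmbedding_subtypeVal

theorem isPlot_iff_contDiff_inclusion {n m : ℕ}
    {p : EuclideanSpace ℝ (Fin m) → Fin n → ℝ × U} :
    IsPlot p ↔ ContDiff ℝ ∞ (inclusion U n ∘ p) := by
  rw [contDiff_pi]
  refine forall_congr' fun i ↦ ⟨fun h ↦ ?_, fun h ↦ ⟨?_, ?_⟩⟩
  · exact ContDiff.prodMk (h.1 : ContDiff ℝ ∞ _) (h.2 : ContDiff ℝ ∞ _)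
  · exact contDiff_fst.comp h
  · exact contDiff_snd.comp h

theorem continuous_of_isPlot {n m : ℕ} {p : EuclideanSpace ℝ (Fin m) → Fin n → ℝ × U}
    (hp : IsPlot p) : Continuous p :=
  (isOpenEmbedding_inclusion n).isInducing.continuous_iff.2
    (isPlot_iff_contDiff_inclusion.1 hp).continuous

theorem isQuotientMap_sigmaRho :
    @IsQuotientMap _ _ _ Diffeology.dTopology (sigmaRho U) := by
  let : TopologicalSpace (FreeDiffeologicalVectorSpace U) := Diffeology.dTopology
  refine ⟨.of_isOpen_preimage_iff_isOpen fun W ↦ ⟨fun hW ↦ ?_, fun hW ↦ ?_⟩, surjective_sigmaRho⟩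
  -- The generating plots factor through `sigmaRho`, so they are continuous for the coinduced
  -- topology.
  · refine dTopology_generateFrom_le
      (t := TopologicalSpace.coinduced (sigmaRho U) inferInstance) (fun q hq ↦ ?_) hW
    obtain ⟨n, -, p, hp, hqp⟩ := hq
    rw [hqp]
    have h : Continuous fun t ↦ (⟨n, p t⟩ : Σ n : ℕ, Fin n → ℝ × U) :=
      (continuous_sigmaMk (σ := fun n : ℕ ↦ Fin n → ℝ × U)).comp (continuous_of_isPlot hp)
    exact @Continuous.comp _ _ _ _ _ (TopologicalSpace.coinduced (sigmaRho U) inferInstance)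
      _ (sigmaRho U) continuous_coinduced_rng h
  · refine isOpen_sigma_iff.2 fun n ↦
      isOpen_of_forall_contDiff (isOpenEmbedding_inclusion n) fun m p hp ↦ ?_
    exact Diffeology.isOpen_iff_preimages_plots.1 hW m _
      (isPlot_rho (isPlot_iff_contDiff_inclusion.2 hp))

theorem t2Space_dTopology :
    @T2Space (FreeDiffeologicalVectorSpace U) Diffeology.dTopology := by
  let : TopologicalSpace (FreeDiffeologicalVectorSpace U) := Diffeology.dTopology
  refine T2Space.of_injective_continuous
    (f := fun v (f : C(U, ℝ)) ↦ lift f v) (fun v w h ↦ ?_) (continuous_pi fun f ↦ ?_)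
  · by_contra hvw
    obtain ⟨f, hf, hne⟩ := exists_continuous_lift_ne hvw
    exact hne (congrFun h ⟨f, hf⟩)
  · refine isQuotientMap_sigmaRho.continuous_iff.2 (continuous_sigma fun n ↦ ?_)
    simp only [Function.comp_def, sigmaRho, lift_rho]
    fun_prop

theorem continuous_sigmaRho_append :
    Continuous fun z : (Σ n : ℕ, Fin n → ℝ × U) × (Σ n : ℕ, Fin n → ℝ × U) ↦
      (⟨z.1.1 + z.2.1, Fin.append z.1.2 z.2.2⟩ : Σ n : ℕ, Fin n → ℝ × U) := by
  refine continuous_iff_continuousAt.2 ?_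
  rintro ⟨⟨m, v⟩, ⟨n, w⟩⟩
  have he : IsOpenEmbedding (Prod.map (Sigma.mk (β := fun n : ℕ ↦ Fin n → ℝ × U) m)
      (Sigma.mk (β := fun n : ℕ ↦ Fin n → ℝ × U) n)) :=
    IsOpenEmbedding.sigmaMk.prodMap IsOpenEmbedding.sigmaMk
  refine (he.continuousAt_iff (x := (v, w))).1 (Continuous.continuousAt ?_)
  have h : Continuous fun z : (Fin m → ℝ × U) × (Fin n → ℝ × U) ↦ Fin.append z.1 z.2 := by
    refine continuous_pi fun i ↦ Fin.addCases (fun i ↦ ?_) (fun i ↦ ?_) i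
    · simp only [Fin.append_left]
      fun_prop
    · simp only [Fin.append_right]
      fun_prop
  exact (continuous_sigmaMk (σ := fun n : ℕ ↦ Fin n → ℝ × U)).comp h

theorem continuous_sigmaRho_smul :
    Continuous fun z : ℝ × (Σ n : ℕ, Fin n → ℝ × U) ↦
      (⟨z.2.1, fun i ↦ (z.1 * (z.2.2 i).1, (z.2.2 i).2)⟩ : Σ n : ℕ, Fin n → ℝ × U) := by
  refine continuous_iff_continuousAt.2 ?_
  rintro ⟨c, ⟨n, v⟩⟩
  have he : IsOpenEmbedding (Prod.map (id : ℝ → ℝ)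
      (Sigma.mk (β := fun n : ℕ ↦ Fin n → ℝ × U) n)) :=
    IsOpenEmbedding.id.prodMap IsOpenEmbedding.sigmaMk
  refine (he.continuousAt_iff (x := (c, v))).1 (Continuous.continuousAt ?_)
  have h : Continuous fun z : ℝ × (Fin n → ℝ × U) ↦
      fun i ↦ (z.1 * (z.2 i).1, (z.2 i).2) := by fun_prop
  exact (continuous_sigmaMk (σ := fun n : ℕ ↦ Fin n → ℝ × U)).comp h

/-- Smooth maps into `(ℝ × U)ᵐ × (ℝ × U)ⁿ` become plots of the product; this drives the nontrivial
half of the product formula. -/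
theorem isOpen_preimage_rho_prod {m n : ℕ}
    {W : Set (FreeDiffeologicalVectorSpace U × FreeDiffeologicalVectorSpace U)}
    (hW : IsOpen[Diffeology.dTopology] W) : IsOpen (Prod.map (rho m) (rho n) ⁻¹' W) := by
  refine isOpen_of_forall_contDiff
    ((isOpenEmbedding_inclusion m).prodMap (isOpenEmbedding_inclusion n)) fun k p hp ↦ ?_
  exact Diffeology.isOpen_iff_preimages_plots.1 hW k (fun t ↦ (rho m (p t).1, rho n (p t).2))
    ⟨isPlot_rho (isPlot_iff_contDiff_inclusion.2 (contDiff_fst.comp hp)),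
      isPlot_rho (isPlot_iff_contDiff_inclusion.2 (contDiff_snd.comp hp))⟩

end

end FreeDiffeologicalVectorSpace

open FreeDiffeologicalVectorSpace in
theorem mainTheorem1 (d : ℕ) (U : TopologicalSpace.Opens (EuclideanSpace ℝ (Fin d))) :
    letI : TopologicalSpace (FreeDiffeologicalVectorSpace U) := Diffeology.dTopology
    (IsTopologicalAddGroup (FreeDiffeologicalVectorSpace U) ∧
      ContinuousSMul ℝ (FreeDiffeologicalVectorSpace U)) ∧
    (T2Space (FreeDiffeologicalVectorSpace U) ∧ NormalSpace (FreeDiffeologicalVectorSpace U)) ∧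
    IsKOmegaSpace (FreeDiffeologicalVectorSpace U) ∧
    (Diffeology.dTopology :
        TopologicalSpace (FreeDiffeologicalVectorSpace U × FreeDiffeologicalVectorSpace U)) =
      instTopologicalSpaceProd := by
  let : TopologicalSpace (FreeDiffeologicalVectorSpace U) := Diffeology.dTopology
  have hq : IsQuotientMap (sigmaRho U) := isQuotientMap_sigmaRho
  have ht2 : T2Space (FreeDiffeologicalVectorSpace U) := t2Space_dTopology
  have : LocallyCompactSpace U := U.isOpen.locallyCompactSpace
  have hqq := hq.prodMap_of_sigmaCompact hq
  have hadd : ContinuousAdd (FreeDiffeologicalVectorSpace U) := ⟨hqq.continuous_iff.2 <|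
    (hq.continuous.comp continuous_sigmaRho_append).congr fun z ↦ sigmaRho_append _ _⟩
  have hsmul : ContinuousSMul ℝ (FreeDiffeologicalVectorSpace U) :=
    ⟨(IsQuotientMap.id.prodMap_of_sigmaCompact hq).continuous_iff.2 <|
      (hq.continuous.comp continuous_sigmaRho_smul).congr fun z ↦ sigmaRho_smul _ _⟩
  have hgroup : IsTopologicalAddGroup (FreeDiffeologicalVectorSpace U) :=
    { continuous_neg := by
        simpa only [neg_one_smul] using
          (continuous_id' (X := FreeDiffeologicalVectorSpace U)).fun_const_smul (-1 : ℝ) }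
  -- Normality follows: σ-compact spaces are Lindelöf, topological groups are regular, and regular
  -- Lindelöf spaces are normal.
  have hσ : SigmaCompactSpace (FreeDiffeologicalVectorSpace U) := by
    rw [← isSigmaCompact_univ_iff, ← hq.surjective.range_eq]
    exact isSigmaCompact_range hq.continuous
  refine ⟨⟨hgroup, hsmul⟩, ⟨ht2, inferInstance⟩,
    (hq.isKOmegaCover default).isKOmegaSpace, le_antisymm (fun W hW ↦ ?_) fun W hW ↦ ?_⟩
  · exact Diffeology.isOpen_iff_preimages_plots.2 fun n p hp ↦
      hW.preimage (hp.1.continuous.prodMk hp.2.continuous)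
  -- A `D`-open set is pulled back along the quotient map `sigmaRho × sigmaRho` and checked on each
  -- open summand.
  · refine hqq.isOpen_preimage.1 (isOpen_iff_mem_nhds.2 ?_)
    rintro ⟨⟨m, v⟩, ⟨n, w⟩⟩ h
    have he : IsOpenEmbedding (Prod.map (Sigma.mk (β := fun n : ℕ ↦ Fin n → ℝ × U) m)
        (Sigma.mk (β := fun n : ℕ ↦ Fin n → ℝ × U) n)) :=
      IsOpenEmbedding.sigmaMk.prodMap IsOpenEmbedding.sigmaMk
    exact Filter.mem_of_superset (he.isOpenMap.image_mem_nhds (x := (v, w))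
      ((isOpen_preimage_rho_prod hW).mem_nhds h)) (image_subset_iff.2 fun z hz ↦ hz)
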